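/- Let $N_d$ be the space dimension and $\gamma>1$. For a state $U=(\rho,\rho u,\rho e)\in\mathbb R\times\mathbb R^{N_d}\times\mathbb R$ put $p=(\gamma-1)\left(\rho e-\tfrac12\rho|u|^2\right)$, $c=\sqrt{\gamma p/\rho}$, $\nu(U)=|u|+c$, $s(U)=\ln p-\gamma\ln\rho+s_0$ (with $s_0\in\mathbb R$ a constant), and let $F(U)=(\rho u,\ \rho u\otimes u+p\,\mathrm I,\ u(\rho e+p))$ be the Euler flux; $|\cdot|$ is the Euclidean norm. Let an element have volume $V_e>0$ and faces $k=1,\dots,N_\partial$, with surface quadrature points $(k,q)$, $q=1,\dots,N^\partial_{q,k}$ (at least one in total), weights $w_{k,q}>0$ and non-zero surface Jacobian vectors $\mathcal J_{k,q}\in\mathbb R^{N_d}$. Let $\hat n_{k,q}=\mathcal J_{k,q}/|\mathcal J_{k,q}|$ be the unit normals, $\zeta_{k,q}=|\mathcal J_{k,q}|w_{k,q}/V_e$ and $S_e=\sum_{k,q}\zeta_{k,q}$, and assume that the surface is closed, $\sum_{k,q}\zeta_{k,q}\hat n_{k,q}=0$. Let $U^+_{k,q}$ be the surface traces of the numerical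 solution at these points, with positive density and pressure, and put $$\lambda^*=\max\left\{\sqrt{N_d},\sqrt{2+\gamma(\gamma-1)}\right\}\ \max_{k,q}\nu(U^+_{k,q}),\qquad U_e^*=\sum_{k,q}\frac{\zeta_{k,q}}{S_e}\left[U^+_{k,q}-\frac1{\lambda^*}F(U^+_{k,q})\cdot\hat n_{k,q}\right].$$ Then $U_e^*$ has positive density and pressure, and $$s(U_e^*)\ \ge\ \min_{k,q}\, s(U^+_{k,q}).$$ -/

import Mathlib

noncomputable section

namespace Euler

/-- A vector of conservative variables `(ρ, ρ u, ρ e)` in `d` space dimensions: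
density, momentum, total energy per unit volume. -/
abbrev State (d : ℕ) : Type := ℝ × EuclideanSpace ℝ (Fin d) × ℝ

variable {d : ℕ}

/-- Density `ρ`. -/
def density (U : State d) : ℝ := U.1

/-- Momentum `ρ u`. -/
def momentum (U : State d) : EuclideanSpace ℝ (Fin d) := U.2.1

/-- Total energy per unit volume `ρ e`. -/
def energy (U : State d) : ℝ := U.2.2

/-- Velocity `u`. -/
def velocity (U : State d) : EuclideanSpace ℝ (Fin d) := (density U)⁻¹ • momentum U

/-- Ideal gas law `p = (γ - 1) (ρ e - ρ |u|² / 2)`. -/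
def pressure (γ : ℝ) (U : State d) : ℝ :=
  (γ - 1) * (energy U - density U * ‖velocity U‖ ^ 2 / 2)

/-- Speed of sound `c = √(γ p / ρ)`. -/
def soundSpeed (γ : ℝ) (U : State d) : ℝ := √(γ * pressure γ U / density U)

/-- Local maximum characteristic speed `ν = |u| + c`. -/
def charSpeed (γ : ℝ) (U : State d) : ℝ := ‖velocity U‖ + soundSpeed γ U

/-- Physical entropy `s = ln p - γ ln ρ + s₀`. -/
def entropy (γ s₀ : ℝ) (U : State d) : ℝ :=
  Real.log (pressure γ U) - γ * Real.log (density U) + s₀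

/-- Admissible (physical) states: positive density and positive pressure. -/
def Admissible (γ : ℝ) (U : State d) : Prop := 0 < density U ∧ 0 < pressure γ U

/-- The `i`-th column of the Euler flux `F(U) = (ρ u, ρ u ⊗ u + p I, u (ρ e + p))`. -/
def flux (γ : ℝ) (U : State d) (i : Fin d) : State d :=
  (density U * velocity U i,
    (density U * velocity U i) • velocity U + pressure γ U • EuclideanSpace.single i 1,
    velocity U i * (energy U + pressure γ U))

/-- The flux in direction `n`, that is `F(U) · n`. -/
def normalFlux (γ : ℝ) (U : State d) (n : EuclideanSpace ℝ (Fin d)) : State d :=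
  ∑ i, n i • flux γ U i

/-- Surface quadrature data of one element: `numFaces` faces, face `k` carrying `numPts k`
quadrature points, with surface Jacobian vectors (nonzero, normal to the face and pointing outward)
and positive quadrature weights, together with the volume of the element. -/
structure SurfaceQuadrature (d : ℕ) where
  numFaces : ℕ
  numPts : Fin numFaces → ℕ
  jac : (k : Fin numFaces) → Fin (numPts k) → EuclideanSpace ℝ (Fin d)
  jac_ne_zero : ∀ k q, jac k q ≠ 0
  weight : (k : Fin numFaces) → Fin (numPts k) → ℝ
  weight_pos : ∀ k q, 0 < weight k q
  vol : ℝ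
  vol_pos : 0 < vol

namespace SurfaceQuadrature

/-- The index set of all surface quadrature points `(k, q)`. -/
abbrev Pt (Q : SurfaceQuadrature d) : Type := (k : Fin Q.numFaces) × Fin (Q.numPts k)

/-- Unit normal at a surface quadrature point. -/
def normal (Q : SurfaceQuadrature d) (k : Fin Q.numFaces) (q : Fin (Q.numPts k)) :
    EuclideanSpace ℝ (Fin d) := ‖Q.jac k q‖⁻¹ • Q.jac k q

/-- `ζ_{k,q} = |J_k(g_{k,q})| w_{k,q} / V`. -/
def zeta (Q : SurfaceQuadrature d) (k : Fin Q.numFaces) (q : Fin (Q.numPts k)) : ℝ :=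
  ‖Q.jac k q‖ * Q.weight k q / Q.vol

/-- `S = ∑_{k,q} ζ_{k,q}`. -/
def surf (Q : SurfaceQuadrature d) : ℝ := ∑ k, ∑ q, Q.zeta k q

/-- The discrete surface is closed: `∑_{k,q} ζ_{k,q} n_{k,q} = 0`. -/
def Closed (Q : SurfaceQuadrature d) : Prop := ∑ k, ∑ q, Q.zeta k q • Q.normal k q = 0

end SurfaceQuadrature

/-- `τ = max {√d, √(2 + γ (γ - 1))}`. -/
def tau (d : ℕ) (γ : ℝ) : ℝ := max (√(d : ℝ)) (√(2 + γ * (γ - 1)))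

/-- `λ* = τ · max ν` over all surface traces. -/
def lambdaStar (γ : ℝ) (Q : SurfaceQuadrature d) [Nonempty Q.Pt]
    (U : (k : Fin Q.numFaces) → Fin (Q.numPts k) → State d) : ℝ :=
  tau d γ * Finset.univ.sup' Finset.univ_nonempty (fun j : Q.Pt => charSpeed γ (U j.1 j.2))

/-- The auxiliary state `U* = ∑_{k,q} (ζ_{k,q} / S) [U_{k,q} - (1/λ*) F(U_{k,q}) · n_{k,q}]`. -/
def auxState (γ : ℝ) (Q : SurfaceQuadrature d) [Nonempty Q.Pt]
    (U : (k : Fin Q.numFaces) → Fin (Q.numPts k) → State d) : State d :=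
  ∑ k, ∑ q, (Q.zeta k q / Q.surf) •
    (U k q - (1 / lambdaStar γ Q U) • normalFlux γ (U k q) (Q.normal k q))

end Euler

end

/-! With K = exp(min s - s₀), every trace lies in the region p ≥ K ρ^γ; let M = max ν and τ = √(2 +
γ(γ - 1)), so λ ≥ τM. A single U - F·n/λ may leave this region (at u = 0 it keeps its density but
loses internal energy), so closedness of the surface is essential.

Let r and ū be the density and velocity of the average, p̄ = K r^γ and c̄² = γ p̄/r. The hyperplane
supporting the region at the state (r, ū, p̄) turns the goal into an affine inequality for the
average. Since ∑ w n = 0, multiples of n may be added to the fluxes, and it suffices to show for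
each trace, with v = u·n and v̄ = ū·n, that (p - p̄)(v - v̄) is at most λ - v times an energy
relative to the supporting state (`pressure_mul_le`).

This is mostly a discriminant condition in v - v̄. It is delicate for rarefied states with v < v̄:
the kinetic term carries the small factor ρ, and λ - v must grow with v̄ - v. That growth comes from
two a priori bounds on the average, c̄ ≤ M (`isentrope_avg_le`) and |ū| ≤ M - 0.28 c̄
(`velocity_avg_le`). -/

/-! ### Scalar inequalities for the relative energy -/

/-- Both sides agree to second order at y = 1, and a Bernoulli bound on y^(1/γ - 1) makes their
difference antitone. -/
theorem sq_one_sub_le_of_le_one {γ : ℝ} (hγ : 1 < γ) {y : ℝ} (hy : 0 < y) (hy1 : y ≤ 1) :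
    (γ - 1) * (1 - y) ^ 2 ≤ 2 * γ * (y + γ - 1 - γ * y ^ γ⁻¹) := by
  have hγ0 : 0 < γ := by linarith
  let f : ℝ → ℝ := fun y => 2 * γ * (y + γ - 1 - γ * y ^ γ⁻¹) - (γ - 1) * (1 - y) ^ 2
  have hd : ∀ y : ℝ, 0 < y → HasDerivAt f
      (2 * γ * (1 - y ^ (γ⁻¹ - 1)) + 2 * (γ - 1) * (1 - y)) y := by
    intro y hy
    have h1 := (Real.hasDerivAt_rpow_const (x := y) (p := γ⁻¹) (Or.inl hy.ne'))
    have h2 := (((((hasDerivAt_id y).add_const γ).sub_const 1).sub (h1.const_mul γ)).const_mul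
      (2 * γ)).sub ((((hasDerivAt_id y).const_sub 1).pow 2).const_mul (γ - 1))
    refine h2.congr_deriv ?_
    simp
    field_simp
  have hanti : AntitoneOn f (Set.Ioc 0 1) := by
    refine antitoneOn_of_deriv_nonpos (convex_Ioc 0 1)
      (fun y hy => (hd y hy.1).continuousAt.continuousWithinAt) ?_ ?_
    · intro y hy
      rw [interior_Ioc] at hy
      exact (hd y hy.1).differentiableAt.differentiableWithinAt
    · intro y hy
      rw [interior_Ioc] at hy
      rw [(hd y hy.1).deriv]
      have h1 : y ^ (γ⁻¹ - 1) ≥ 1 + (1 - γ⁻¹) * (1 - y) := by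
        rw [Real.rpow_def_of_pos hy.1]
        have h2 := Real.add_one_le_exp (Real.log y * (γ⁻¹ - 1))
        have h3 := Real.log_le_sub_one_of_pos hy.1
        have h4 : γ⁻¹ ≤ 1 := inv_le_one_of_one_le₀ hγ.le
        nlinarith
      have h2 : γ * γ⁻¹ = 1 := mul_inv_cancel₀ hγ0.ne'
      have h3 : γ * (1 + (1 - γ⁻¹) * (1 - y)) = γ + (γ - 1) * (1 - y) := by
        field_simp
      linarith [mul_le_mul_of_nonneg_left h1 hγ0.le]
  have h := hanti ⟨hy, hy1⟩ ⟨one_pos, le_rfl⟩ hy1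
  simp only [f, Real.one_rpow] at h
  linarith

/-- Dividing by y first makes the difference of the two sides monotone, by Bernoulli for the
exponent 1 - 1/γ in (0, 1) applied to 1/y. -/
theorem sq_sub_one_le_of_one_le {γ : ℝ} (hγ : 1 < γ) {y : ℝ} (hy1 : 1 ≤ y) :
    (γ - 1) * (y - 1) ^ 2 ≤ 2 * γ * y * (y + γ - 1 - γ * y ^ γ⁻¹) := by
  have hγ0 : 0 < γ := by linarith
  let f : ℝ → ℝ := fun y => 2 * γ * (y + γ - 1 - γ * y ^ γ⁻¹) - (γ - 1) * (y - 2 + y⁻¹)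
  have hd : ∀ y : ℝ, 0 < y → HasDerivAt f
      (2 * γ * (1 - y ^ (γ⁻¹ - 1)) - (γ - 1) * (1 - y⁻¹ ^ 2)) y := by
    intro y hy
    have h1 := (Real.hasDerivAt_rpow_const (x := y) (p := γ⁻¹) (Or.inl hy.ne'))
    have h2 := (((((hasDerivAt_id y).add_const γ).sub_const 1).sub (h1.const_mul γ)).const_mul
      (2 * γ)).sub ((((hasDerivAt_id y).sub_const 2).add (hasDerivAt_inv hy.ne')).const_mul (γ - 1))
    refine h2.congr_deriv ?_
    field_simp
    ring
  have hmono : MonotoneOn f (Set.Ici 1) := by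
    refine monotoneOn_of_deriv_nonneg (convex_Ici 1)
      (fun y hy => (hd y (lt_of_lt_of_le one_pos hy)).continuousAt.continuousWithinAt) ?_ ?_
    · intro y hy
      rw [interior_Ici] at hy
      exact (hd y (one_pos.trans hy)).differentiableAt.differentiableWithinAt
    · intro y hy
      rw [interior_Ici] at hy
      have hy0 : 0 < y := one_pos.trans hy
      rw [(hd y hy0).deriv]
      have hi : y⁻¹ ≤ 1 := inv_le_one_of_one_le₀ (le_of_lt hy)
      have hi0 : 0 < y⁻¹ := inv_pos.2 hy0
      have h4 : γ⁻¹ ≤ 1 := inv_le_one_of_one_le₀ hγ.le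
      have h5 : 0 < γ⁻¹ := inv_pos.2 hγ0
      have h1 : y ^ (γ⁻¹ - 1) ≤ 1 + (1 - γ⁻¹) * (y⁻¹ - 1) := by
        have := rpow_one_add_le_one_add_mul_self (s := y⁻¹ - 1) (by linarith)
          (p := 1 - γ⁻¹) (by linarith) (by linarith)
        rwa [add_sub_cancel, Real.inv_rpow hy0.le, ← Real.rpow_neg hy0.le, neg_sub] at this
      have h2 : γ * γ⁻¹ = 1 := mul_inv_cancel₀ hγ0.ne'
      have h6 : γ * (1 - y ^ (γ⁻¹ - 1)) ≥ (γ - 1) * (1 - y⁻¹) := by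
        nlinarith [mul_le_mul_of_nonneg_left h1 hγ0.le]
      nlinarith [mul_nonneg (sub_nonneg.2 hγ.le) (sq_nonneg (1 - y⁻¹))]
  have h := hmono (Set.mem_Ici.2 le_rfl) hy1 hy1
  have hy0 : 0 < y := one_pos.trans_le hy1
  simp only [f, Real.one_rpow] at h
  have h2 : y * y⁻¹ = 1 := mul_inv_cancel₀ hy0.ne'
  have h3 : 0 ≤ 2 * γ * (y + γ - 1 - γ * y ^ γ⁻¹) - (γ - 1) * (y - 2 + y⁻¹) := by
    norm_num at h ⊢
    linarith
  nlinarith [mul_nonneg hy0.le h3]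

theorem le_rpow_inv_of_rpow_le {γ x y : ℝ} (hγ : 0 < γ) (hx : 0 < x) (h : x ^ γ ≤ y) :
    x ≤ y ^ γ⁻¹ := by
  have := Real.rpow_le_rpow (Real.rpow_nonneg hx.le γ) h (inv_pos.2 hγ).le
  rwa [Real.rpow_rpow_inv hx.le hγ.ne'] at this

/-- Discriminant criterion for a quadratic in D. -/
theorem mul_le_of_sq_le {N k I t D : ℝ} (hN : 0 < N) (hk : 0 < k)
    (h : t ^ 2 ≤ 2 * N ^ 2 * k * I) : t * D ≤ N * (I + k * D ^ 2 / 2) := by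
  have h1 : 0 ≤ (2 * (N * k)) * (N * (I + k * D ^ 2 / 2) - t * D) := by
    nlinarith [sq_nonneg (t - N * k * D)]
  have := nonneg_of_mul_nonneg_right h1 (by positivity)
  linarith

/-- The tangent to τ at γ = 1 has slope √2/4, which exceeds (log 2)/2, the rate at which
√((1/2)^(γ-1)) can decrease. The slopes compensate and N ≥ √2. -/
theorem one_le_sq_mul_of_half_le {γ τ x N : ℝ} (hγ : 1 < γ) (hτ0 : 0 < τ)
    (hτ : τ ^ 2 = 2 + γ * (γ - 1)) (hx : 1 / 2 ≤ x)
    (hN : τ - 1 + √(x ^ γ / x) ≤ N) : 1 ≤ N ^ 2 * x := by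
  have hx0 : 0 < x := by linarith
  have h2 : (√2) ^ 2 = 2 := Real.sq_sqrt (by norm_num)
  have h2p : 0 < √2 := by positivity
  have h2l : 1.414 < √2 := by
    rw [Real.lt_sqrt (by norm_num)]; norm_num
  have h2u : √2 < 1.4143 := by
    rw [Real.sqrt_lt' (by norm_num)]; norm_num
  have hτl : √2 + (γ - 1) * (√2 / 4) ≤ τ := by
    refine (pow_le_pow_iff_left₀ (by have := sub_pos.2 hγ; positivity) hτ0.le two_ne_zero).1 ?_
    nlinarith [sq_nonneg (γ - 1)]
  have h3 : 1 - (γ - 1) * (√2 / 4) ≤ √((1 / 2 : ℝ) ^ (γ - 1)) := by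
    rw [Real.sqrt_eq_rpow ((1 / 2 : ℝ) ^ (γ - 1)), ← Real.rpow_mul (by norm_num), Real.rpow_def_of_pos (by norm_num)]
    have := Real.add_one_le_exp (Real.log (1 / 2) * ((γ - 1) * (1 / 2)))
    have hl : Real.log (1 / 2) = - Real.log 2 := by rw [one_div, Real.log_inv]
    rw [hl] at this ⊢
    have := Real.log_two_lt_d9
    nlinarith
  have h4 : √((1 / 2 : ℝ) ^ (γ - 1)) ≤ √(x ^ γ / x) := by
    apply Real.sqrt_le_sqrt
    rw [← Real.rpow_sub_one hx0.ne']
    exact Real.rpow_le_rpow (by norm_num) hx (by linarith)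
  have h5 : √2 ≤ N := by linarith
  nlinarith

/-- With x⁻¹ = 2eᵗ, t ≥ 0, the bound eᵗ ≥ 1 + t + t²/2 leaves a quadratic inequality in t. The
constant 2.19 is nearly sharp at x = 1/2. -/
theorem sq_le_mul_inv_sub_one_add_log {x : ℝ} (hx0 : 0 < x) (hx : x ≤ 1 / 2) :
    (-Real.log x + 1 / 8) ^ 2 ≤ 2.19 * (x⁻¹ - 1 + Real.log x) := by
  set t := -Real.log x - Real.log 2 with ht
  have ht0 : 0 ≤ t := by
    have := Real.log_le_log hx0 hx
    rw [one_div, Real.log_inv] at this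
    linarith
  have he : x⁻¹ = 2 * Real.exp t := by
    rw [ht, Real.exp_sub, Real.exp_neg, Real.exp_log hx0, Real.exp_log two_pos]
    field_simp
  have hq := Real.quadratic_le_exp_of_nonneg ht0
  have hl : Real.log x = -t - Real.log 2 := by rw [ht]; ring
  have h1 := Real.log_two_lt_d9
  have h2 := Real.log_two_gt_d9
  rw [he, hl]
  nlinarith

/-- Replacing x^γ by its lower bound x(1 - (γ - 1)z), z = -log x, only strengthens the claim. The
terms H·D then cancel, leaving the cubic inequality `hmain` in D. -/
theorem mul_le_of_le_half {γ τ x N D : ℝ} (hγ : 1 < γ) (hτ0 : 0 < τ)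
    (hτ : τ ^ 2 = 2 + γ * (γ - 1)) (hx0 : 0 < x) (hx : x ≤ 1 / 2) (hD : 0 ≤ D)
    (hJ : 0 ≤ x ^ γ + γ - 1 - γ * x)
    (hN : τ - 0.72 + D ≤ N) :
    (1 - x ^ γ) * D ≤ N * ((x ^ γ + γ - 1 - γ * x) / (γ - 1) + γ * x * D ^ 2 / 2) := by
  have hκ : 0 < γ - 1 := by linarith
  have hγ0 : 0 < γ := by linarith
  set z := -Real.log x with hz
  set q := x ^ γ with hq
  set a := τ - 0.72 with ha
  have ha0 : 0 < a := by
    have : 1.4 < τ := by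
      apply lt_of_pow_lt_pow_left₀ 2 hτ0.le
      nlinarith
    linarith
  have hH := sq_le_mul_inv_sub_one_add_log hx0 hx
  set H := x⁻¹ - 1 - z with hHd
  have hH' : (z + 1 / 8) ^ 2 ≤ 2.19 * H := by
    have : H = x⁻¹ - 1 + Real.log x := by rw [hHd, hz]; ring
    rw [this]; exact hH
  have hH0 : 0 ≤ H := by nlinarith [sq_nonneg (z + 1 / 8)]
  have hz0 : 0 ≤ z := by
    have := Real.log_nonpos hx0.le (by linarith)
    linarith
  have hq1 : x * (1 - (γ - 1) * z) ≤ q := by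
    have : q = x * Real.exp (-(γ - 1) * z) := by
      rw [hq, hz]
      conv_rhs => rw [← Real.exp_log hx0]
      rw [Real.rpow_def_of_pos hx0, ← Real.exp_add, Real.log_exp]
      congr 1; ring
    rw [this]
    have := Real.add_one_le_exp (-(γ - 1) * z)
    apply mul_le_mul_of_nonneg_left _ hx0.le
    linarith
  have hxH : x * H = 1 - x - x * z := by
    rw [hHd]; field_simp
  have hJq : (q + γ - 1 - γ * x) / (γ - 1) = x * H + (q - x * (1 - (γ - 1) * z)) / (γ - 1) := by
    rw [hxH]; field_simp; ring
  have hb : 2.19 * γ ≤ 2 * (a * (a + 1)) := by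
    rw [ha]
    nlinarith [sq_nonneg (τ - 1.45), sq_nonneg (γ - 1.15)]
  have hquad : 0 ≤ a * H + γ * ((a + 1) / 2 * D ^ 2 - (z + 1 / 8) * D) := by
    have h1 := mul_le_of_sq_le (N := 1) (k := γ * (a + 1)) (I := a * H) (t := γ * (z + 1 / 8))
      (D := D) one_pos (by positivity) (by
        have h2 : γ * (z + 1 / 8) ^ 2 ≤ 2 * (a * (a + 1)) * H := by
          nlinarith [mul_le_mul_of_nonneg_left hH' hγ0.le, mul_le_mul_of_nonneg_right hb hH0]
        nlinarith [mul_le_mul_of_nonneg_left h2 hγ0.le])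
    nlinarith
  -- D(D - 1/2)² ≥ 0 bounds D³ below by D² - D/4; this is the source of the 1/8 and of a + 1 in
  -- `hquad`.
  have hmain : 0 ≤ a * H + γ * (a * D ^ 2 / 2 + D ^ 3 / 2 - z * D) := by
    nlinarith [mul_nonneg hγ0.le (mul_nonneg hD (sq_nonneg (D - 1 / 2)))]
  have hI : 0 ≤ (q + γ - 1 - γ * x) / (γ - 1) + γ * x * D ^ 2 / 2 := by positivity
  refine le_trans ?_ (mul_le_mul_of_nonneg_right hN hI)
  rw [hJq]
  have h1 : 0 ≤ (q - x * (1 - (γ - 1) * z)) / (γ - 1) := div_nonneg (by linarith) hκ.le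
  have h2 := mul_nonneg hx0.le hmain
  nlinarith [mul_nonneg (add_nonneg ha0.le hD) h1, mul_nonneg hD (sub_nonneg.2 hq1)]

/-- Here x and y are the density and pressure ratios to the supporting state, D and N are v - v̄ and
λ - v in units of c̄. For y ≥ 1 the discriminant needs N² ≥ y/x, the squared ratio of sound speeds.
-/
theorem scaled_pointwise {γ τ x y N D : ℝ} (hγ : 1 < γ) (hτ0 : 0 < τ)
    (hτ : τ ^ 2 = 2 + γ * (γ - 1)) (hx0 : 0 < x) (hxy : x ^ γ ≤ y)
    (hN : τ - 1 + √(y / x) ≤ N) (hND : τ - 0.72 - D ≤ N) :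
    (y - 1) * D ≤ N * ((y + γ - 1 - γ * x) / (γ - 1) + γ * x * D ^ 2 / 2) := by
  have hκ : 0 < γ - 1 := by linarith
  have hγ0 : 0 < γ := by linarith
  have hq0 : 0 < x ^ γ := Real.rpow_pos_of_pos hx0 γ
  have hy0 : 0 < y := hq0.trans_le hxy
  have hτ1 : 1 < τ := by
    apply lt_of_pow_lt_pow_left₀ 2 hτ0.le
    nlinarith
  have hxr := le_rpow_inv_of_rpow_le hγ0 hx0 hxy
  have hs : 0 ≤ √(y / x) := Real.sqrt_nonneg _
  have hN0 : 0 < N := by linarith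
  rcases le_or_gt 1 y with hy1 | hy1
  · have h := sq_sub_one_le_of_one_le hγ hy1
    apply mul_le_of_sq_le hN0 (by positivity)
    have h1 : y ≤ N ^ 2 * x := by
      have : √(y / x) ^ 2 ≤ N ^ 2 := by
        apply pow_le_pow_left₀ hs; linarith
      rw [Real.sq_sqrt (by positivity), div_le_iff₀ hx0] at this
      exact this
    have hI : 0 ≤ y + γ - 1 - γ * y ^ γ⁻¹ := by
      have : 0 ≤ (2 * γ * y) * (y + γ - 1 - γ * y ^ γ⁻¹) := le_trans (by positivity) h
      exact nonneg_of_mul_nonneg_right this (by positivity)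
    have h2 : (y - 1) ^ 2 ≤ 2 * γ * y * ((y + γ - 1 - γ * x) / (γ - 1)) := by
      rw [mul_div_assoc', le_div_iff₀ hκ, mul_comm]
      refine h.trans (mul_le_mul_of_nonneg_left ?_ (by positivity))
      nlinarith
    have hI2 : 0 ≤ (y + γ - 1 - γ * x) / (γ - 1) := div_nonneg (by nlinarith) hκ.le
    nlinarith [mul_le_mul_of_nonneg_right h1 (mul_nonneg hγ0.le hI2)]
  · have hq1 : x ^ γ < 1 := hxy.trans_lt hy1
    have h := sq_one_sub_le_of_le_one hγ hq0 hq1.le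
    rw [Real.rpow_rpow_inv hx0.le hγ0.ne'] at h
    have hJ : 0 ≤ x ^ γ + γ - 1 - γ * x := by
      have : 0 ≤ (2 * γ) * (x ^ γ + γ - 1 - γ * x) := le_trans (by positivity) h
      exact nonneg_of_mul_nonneg_right this (by positivity)
    have hJI : (x ^ γ + γ - 1 - γ * x) / (γ - 1) ≤ (y + γ - 1 - γ * x) / (γ - 1) := by
      gcongr
    have hJ' : 0 ≤ (x ^ γ + γ - 1 - γ * x) / (γ - 1) := div_nonneg hJ hκ.le
    rcases le_or_gt 0 D with hD | hD
    · refine le_trans (mul_nonpos_of_nonpos_of_nonneg (by linarith) hD) ?_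
      have := hJ'.trans hJI
      positivity
    -- Only expansion with D < 0 remains. Lowering y to x^γ is the worst case: it increases the left
    -- side and decreases the relative energy.
    · have key : (1 - x ^ γ) * (-D) ≤
          N * ((x ^ γ + γ - 1 - γ * x) / (γ - 1) + γ * x * (-D) ^ 2 / 2) := by
        rcases le_or_gt (1 / 2) x with hx | hx
        · apply mul_le_of_sq_le hN0 (by positivity)
          have h1 := one_le_sq_mul_of_half_le hγ hτ0 hτ hx (N := N) (by
            have : √(x ^ γ / x) ≤ √(y / x) := by gcongr
            linarith)
          have h2 : (1 - x ^ γ) ^ 2 ≤ 2 * γ * ((x ^ γ + γ - 1 - γ * x) / (γ - 1)) := by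
            rw [mul_div_assoc', le_div_iff₀ hκ, mul_comm]
            exact h
          nlinarith [mul_le_mul_of_nonneg_right h1 (mul_nonneg hγ0.le hJ')]
        · exact mul_le_of_le_half hγ hτ0 hτ hx0 hx.le (by linarith) hJ (by linarith)
      have h3 := mul_le_mul_of_nonneg_left hJI hN0.le
      nlinarith

theorem pressure_mul_le {γ τ M lam ρ p ρb pb v vb : ℝ} (hγ : 1 < γ) (hτ0 : 0 < τ)
    (hτ : τ ^ 2 = 2 + γ * (γ - 1)) (hρ : 0 < ρ) (hρb : 0 < ρb) (hpb : 0 < pb)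
    (hp : pb * (ρ / ρb) ^ γ ≤ p) (hcM : √(γ * pb / ρb) ≤ M) (hlam : τ * M ≤ lam)
    (hv : v + √(γ * p / ρ) ≤ M) (hvb : vb ≤ M - 0.28 * √(γ * pb / ρb)) :
    (p - pb) * (v - vb) ≤
      (lam - v) * (p / (γ - 1) + ρ * (v - vb) ^ 2 / 2 - γ / (γ - 1) * ρ * (pb / ρb) + pb) := by
  have hκ : 0 < γ - 1 := by linarith
  have hγ0 : 0 < γ := by linarith
  have hτ1 : 1 < τ := by
    apply lt_of_pow_lt_pow_left₀ 2 hτ0.le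
    nlinarith
  set c := √(γ * p / ρ) with hc
  set cb := √(γ * pb / ρb) with hcb
  have hcb0 : 0 < cb := Real.sqrt_pos.2 (by positivity)
  have hcb2 : cb ^ 2 = γ * pb / ρb := Real.sq_sqrt (by positivity)
  have hcc : √(p / pb / (ρ / ρb)) = c / cb := by
    rw [hc, hcb, ← Real.sqrt_div' _ (by positivity)]
    congr 1
    field_simp
  have h := scaled_pointwise (x := ρ / ρb) (y := p / pb) (N := (lam - v) / cb)
    (D := (v - vb) / cb) hγ hτ0 hτ (by positivity) (by rw [le_div_iff₀ hpb]; linarith)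
    (by
      rw [hcc, le_div_iff₀ hcb0, add_mul, div_mul_cancel₀ _ hcb0.ne']
      nlinarith)
    (by
      rw [le_div_iff₀ hcb0, sub_mul, div_mul_cancel₀ _ hcb0.ne']
      nlinarith)
  have h1 := mul_le_mul_of_nonneg_left h (mul_pos hpb hcb0).le
  have e1 : pb * cb * ((p / pb - 1) * ((v - vb) / cb)) = (p - pb) * (v - vb) := by
    field_simp
  have e2 : pb * cb * ((lam - v) / cb * ((p / pb + γ - 1 - γ * (ρ / ρb)) / (γ - 1) +
      γ * (ρ / ρb) * ((v - vb) / cb) ^ 2 / 2)) =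
      (lam - v) * (p / (γ - 1) + ρ * (v - vb) ^ 2 / 2 - γ / (γ - 1) * ρ * (pb / ρb) + pb) := by
    rw [div_pow, hcb2]
    field_simp
    ring
  rwa [e1, e2] at h1

/-! ### A priori bounds and the entropy principle for averaged fluxes -/

section Average

variable {ι E : Type*} [Fintype ι] [NormedAddCommGroup E] [InnerProductSpace ℝ E]

/-- Hypotheses on a family of gas states `(ρ i, u i, p i)` with directions `n i` and weights `w i`:
all states lie in the region `K ρ ^ γ ≤ p`, have maximal characteristic speed at most `M`, and
`lam` is at least `√(2 + γ (γ - 1)) M`. -/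
structure FluxAverageData (γ K M lam : ℝ) (w ρ p : ι → ℝ) (u n : ι → E) : Prop where
  one_lt : 1 < γ
  K_pos : 0 < K
  weight_nonneg : ∀ i, 0 ≤ w i
  sum_weight : ∑ i, w i = 1
  sum_normal : ∑ i, w i • n i = 0
  norm_normal : ∀ i, ‖n i‖ = 1
  density_pos : ∀ i, 0 < ρ i
  le_pressure : ∀ i, K * ρ i ^ γ ≤ p i
  speed_le : ∀ i, ‖u i‖ + √(γ * p i / ρ i) ≤ M
  le_lam : √(2 + γ * (γ - 1)) * M ≤ lam

namespace FluxAverageData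

variable {γ K M lam : ℝ} {w ρ p : ι → ℝ} {u n : ι → E}

theorem gamma_pos (h : FluxAverageData γ K M lam w ρ p u n) : 0 < γ := one_pos.trans h.one_lt

theorem pressure_pos (h : FluxAverageData γ K M lam w ρ p u n) (i : ι) : 0 < p i :=
  (mul_pos h.K_pos (Real.rpow_pos_of_pos (h.density_pos i) γ)).trans_le (h.le_pressure i)

theorem nonempty (h : FluxAverageData γ K M lam w ρ p u n) : Nonempty ι := by
  by_contra hne
  rw [not_nonempty_iff] at hne
  have := h.sum_weight
  simp at this

theorem M_pos (h : FluxAverageData γ K M lam w ρ p u n) : 0 < M := by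
  obtain ⟨i⟩ := h.nonempty
  have h1 := h.pressure_pos i
  have h2 := h.density_pos i
  have h3 := h.gamma_pos
  have : 0 < √(γ * p i / ρ i) := Real.sqrt_pos.2 (by positivity)
  linarith [norm_nonneg (u i), h.speed_le i]

theorem sq_tau (h : FluxAverageData γ K M lam w ρ p u n) :
    √(2 + γ * (γ - 1)) ^ 2 = 2 + γ * (γ - 1) :=
  Real.sq_sqrt (by nlinarith [h.one_lt])

theorem one_lt_tau (h : FluxAverageData γ K M lam w ρ p u n) : 1.4 < √(2 + γ * (γ - 1)) := by
  rw [Real.lt_sqrt (by norm_num)]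
  nlinarith [h.one_lt]

theorem lam_pos (h : FluxAverageData γ K M lam w ρ p u n) : 0 < lam := by
  nlinarith [h.one_lt_tau, h.M_pos, h.le_lam]

theorem abs_inner_le (h : FluxAverageData γ K M lam w ρ p u n) (x : E) (i : ι) :
    |inner ℝ x (n i)| ≤ ‖x‖ := by
  have := abs_real_inner_le_norm x (n i)
  rwa [h.norm_normal, mul_one] at this

theorem norm_le (h : FluxAverageData γ K M lam w ρ p u n) (i : ι) : ‖u i‖ ≤ M :=
  (le_add_of_nonneg_right (Real.sqrt_nonneg _)).trans (h.speed_le i)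

theorem inner_lt (h : FluxAverageData γ K M lam w ρ p u n) (i : ι) :
    inner ℝ (u i) (n i) < lam := by
  have h1 := le_of_abs_le (h.abs_inner_le (u i) i)
  nlinarith [h.one_lt_tau, h.M_pos, h.le_lam, h.norm_le i]

theorem factor_pos (h : FluxAverageData γ K M lam w ρ p u n) (i : ι) :
    0 < 1 - inner ℝ (u i) (n i) / lam := by
  rw [sub_pos, div_lt_one h.lam_pos]
  exact h.inner_lt i

theorem exists_weight_pos (h : FluxAverageData γ K M lam w ρ p u n) : ∃ i, 0 < w i := by
  by_contra! hw
  have : ∑ i, w i ≤ 0 := Finset.sum_nonpos fun i _ => hw i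
  linarith [h.sum_weight]

theorem density_avg_pos (h : FluxAverageData γ K M lam w ρ p u n) :
    0 < ∑ i, w i * (ρ i * (1 - inner ℝ (u i) (n i) / lam)) := by
  obtain ⟨i, hi⟩ := h.exists_weight_pos
  refine Finset.sum_pos' (fun j _ => ?_) ⟨i, Finset.mem_univ i, ?_⟩
  · exact mul_nonneg (h.weight_nonneg j) (mul_pos (h.density_pos j) (h.factor_pos j)).le
  · exact mul_pos hi (mul_pos (h.density_pos i) (h.factor_pos i))

/-- The sound speed at density `r` on the isentrope `p = K r ^ γ`. -/
theorem sqrt_isentrope (h : FluxAverageData γ K M lam w ρ p u n) {r : ℝ} (hr : 0 < r) :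
    √(γ * (K * r ^ γ) / r) = √(γ * K) * r ^ ((γ - 1) / 2) := by
  have h1 := h.gamma_pos
  have h2 := h.K_pos
  have : γ * (K * r ^ γ) / r = (γ * K) * r ^ (γ - 1) := by
    rw [Real.rpow_sub_one hr.ne']; ring
  rw [this, Real.sqrt_mul (by positivity), Real.sqrt_eq_rpow (r ^ (γ - 1)), ← Real.rpow_mul hr.le]
  ring_nf

theorem isentrope_le_soundSpeed (h : FluxAverageData γ K M lam w ρ p u n) (i : ι) :
    √(γ * K) * ρ i ^ ((γ - 1) / 2) ≤ √(γ * p i / ρ i) := by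
  have h1 := h.gamma_pos
  have h2 := h.density_pos i
  rw [← h.sqrt_isentrope h2]
  apply Real.sqrt_le_sqrt
  have := h.le_pressure i
  gcongr

/-- Some index has ρ(1 - v/λ) ≥ r. There the gain in density is at most exp(|u|/λ), while c ≤ M -
|u| ≤ M exp(-|u|/M); the two exponentials balance because (γ - 1)M/2 ≤ λ. -/
theorem isentrope_avg_le (h : FluxAverageData γ K M lam w ρ p u n) {r : ℝ}
    (hr : r = ∑ i, w i * (ρ i * (1 - inner ℝ (u i) (n i) / lam))) :
    √(γ * K) * r ^ ((γ - 1) / 2) ≤ M := by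
  have hr0 : 0 < r := hr ▸ h.density_avg_pos
  have hM := h.M_pos
  have hlam := h.lam_pos
  have hκ := h.one_lt
  have hτ := h.one_lt_tau
  set s := (γ - 1) / 2 with hs
  have hs0 : 0 ≤ s := by rw [hs]; linarith
  have hsτ : s * M ≤ lam := by
    refine le_trans ?_ h.le_lam
    apply mul_le_mul_of_nonneg_right _ hM.le
    apply Real.le_sqrt_of_sq_le
    rw [hs]
    nlinarith
  obtain ⟨i, hi⟩ : ∃ i, r ≤ ρ i * (1 - inner ℝ (u i) (n i) / lam) := by
    by_contra! hlt
    obtain ⟨i, hi⟩ := h.exists_weight_pos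
    have : ∑ i, w i * (ρ i * (1 - inner ℝ (u i) (n i) / lam)) < ∑ i, w i * r := by
      refine Finset.sum_lt_sum (fun j _ => ?_) ⟨i, Finset.mem_univ i, ?_⟩
      · exact mul_le_mul_of_nonneg_left (hlt j).le (h.weight_nonneg j)
      · exact mul_lt_mul_of_pos_left (hlt i) hi
    rw [← Finset.sum_mul, h.sum_weight, one_mul, ← hr] at this
    exact lt_irrefl _ this
  have hfac : (1 - inner ℝ (u i) (n i) / lam) ^ s ≤ Real.exp (‖u i‖ / M) := by
    have h1 : 1 - inner ℝ (u i) (n i) / lam ≤ Real.exp (‖u i‖ / lam) := by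
      have h2 := neg_le_of_abs_le (h.abs_inner_le (u i) i)
      have h3 := Real.add_one_le_exp (‖u i‖ / lam)
      have h4 : -(inner ℝ (u i) (n i) / lam) ≤ ‖u i‖ / lam := by
        rw [← neg_div]
        gcongr
        linarith
      linarith
    refine (Real.rpow_le_rpow (h.factor_pos i).le h1 hs0).trans ?_
    rw [← Real.exp_mul]
    apply Real.exp_le_exp.2
    rw [div_mul_eq_mul_div, div_le_div_iff₀ hlam hM, mul_assoc]
    exact mul_le_mul_of_nonneg_left hsτ (norm_nonneg _)
  have hsub : 1 - ‖u i‖ / M ≤ Real.exp (-(‖u i‖ / M)) := by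
    linarith [Real.add_one_le_exp (-(‖u i‖ / M))]
  have hc := h.isentrope_le_soundSpeed i
  rw [← hs] at hc
  calc √(γ * K) * r ^ s
      ≤ √(γ * K) * (ρ i * (1 - inner ℝ (u i) (n i) / lam)) ^ s := by gcongr
    _ = √(γ * K) * ρ i ^ s * (1 - inner ℝ (u i) (n i) / lam) ^ s := by
        rw [Real.mul_rpow (h.density_pos i).le (h.factor_pos i).le]; ring
    _ ≤ (M * (1 - ‖u i‖ / M)) * Real.exp (‖u i‖ / M) := by
        have : √(γ * K) * ρ i ^ s ≤ M * (1 - ‖u i‖ / M) := by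
          have e : M * (1 - ‖u i‖ / M) = M - ‖u i‖ := by field_simp
          rw [e]
          linarith [h.speed_le i]
        refine mul_le_mul this hfac (Real.rpow_nonneg (h.factor_pos i).le s) (le_trans ?_ this)
        exact mul_nonneg (Real.sqrt_nonneg _) (Real.rpow_nonneg (h.density_pos i).le s)
    _ ≤ (M * Real.exp (-(‖u i‖ / M))) * Real.exp (‖u i‖ / M) := by gcongr
    _ = M := by rw [mul_assoc, ← Real.exp_add]; simp

/-- Weighted power-mean inequality, obtained from the tangent of `x ↦ x ^ (1 + (γ - 1) / 2)`. -/
theorem rpow_avg_le (h : FluxAverageData γ K M lam w ρ p u n) {r : ℝ}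
    (hr : r = ∑ i, w i * (ρ i * (1 - inner ℝ (u i) (n i) / lam))) :
    r * r ^ ((γ - 1) / 2) * (1 - (γ - 1) / (2 * √(2 + γ * (γ - 1)))) ≤
      ∑ i, w i * (ρ i * (1 - inner ℝ (u i) (n i) / lam)) * ρ i ^ ((γ - 1) / 2) := by
  have hr0 : 0 < r := hr ▸ h.density_avg_pos
  have hlam := h.lam_pos
  have hγ := h.one_lt
  have hτ := h.one_lt_tau
  set τ := √(2 + γ * (γ - 1)) with hτd
  set s := (γ - 1) / 2 with hs
  have hs0 : 0 ≤ s := by rw [hs]; linarith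
  have htan : ∀ i, (1 + s) * r ^ s * ρ i - s * (r * r ^ s) ≤ ρ i * ρ i ^ s := by
    intro i
    have hρ := h.density_pos i
    have h1 := one_add_mul_self_le_rpow_one_add (s := ρ i / r - 1) (p := 1 + s)
      (by have := div_pos hρ hr0; linarith) (by linarith)
    rw [add_sub_cancel, Real.rpow_add (div_pos hρ hr0), Real.rpow_one,
      Real.div_rpow hρ.le hr0.le] at h1
    have hrs : 0 < r ^ s := Real.rpow_pos_of_pos hr0 s
    have h2 := mul_le_mul_of_nonneg_left h1 (mul_pos hr0 hrs).le
    have e1 : r * r ^ s * (ρ i / r * (ρ i ^ s / r ^ s)) = ρ i * ρ i ^ s := by field_simp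
    have e2 : r * r ^ s * (1 + (1 + s) * (ρ i / r - 1)) =
        (1 + s) * r ^ s * ρ i - s * (r * r ^ s) := by field_simp; ring
    rwa [e1, e2] at h2
  -- The weights w(1 - v/λ) in the tangent inequality need not sum to one; their possible excess 1/τ
  -- costs the factor 1 - (γ - 1)/(2τ).
  have hA : ∑ i, w i * (1 - inner ℝ (u i) (n i) / lam) ≤ 1 + 1 / τ := by
    have : ∀ i, w i * (1 - inner ℝ (u i) (n i) / lam) ≤ w i * (1 + 1 / τ) := by
      intro i
      apply mul_le_mul_of_nonneg_left _ (h.weight_nonneg i)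
      have h2 := neg_le_of_abs_le (h.abs_inner_le (u i) i)
      have h3 : -(inner ℝ (u i) (n i) / lam) ≤ 1 / τ := by
        rw [← neg_div, div_le_div_iff₀ hlam (by linarith)]
        nlinarith [h.le_lam, h.norm_le i]
      linarith
    refine (Finset.sum_le_sum fun i _ => this i).trans ?_
    rw [← Finset.sum_mul, h.sum_weight, one_mul]
  have hsum : ∑ i, w i * (1 - inner ℝ (u i) (n i) / lam) *
      ((1 + s) * r ^ s * ρ i - s * (r * r ^ s)) ≤
      ∑ i, w i * (ρ i * (1 - inner ℝ (u i) (n i) / lam)) * ρ i ^ s := by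
    refine Finset.sum_le_sum fun i _ => ?_
    have := mul_le_mul_of_nonneg_left (htan i)
      (mul_nonneg (h.weight_nonneg i) (h.factor_pos i).le)
    linarith
  have e : ∑ i, w i * (1 - inner ℝ (u i) (n i) / lam) *
      ((1 + s) * r ^ s * ρ i - s * (r * r ^ s)) =
      (1 + s) * r ^ s * r - s * (r * r ^ s) * ∑ i, w i * (1 - inner ℝ (u i) (n i) / lam) := by
    conv_rhs => enter [1, 2]; rw [hr]
    rw [Finset.mul_sum, Finset.mul_sum, ← Finset.sum_sub_distrib]
    refine Finset.sum_congr rfl fun i _ => ?_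
    ring
  have hrs : 0 ≤ s * (r * r ^ s) := by positivity
  have e3 : (γ - 1) / (2 * τ) = s * (1 / τ) := by rw [hs]; field_simp
  rw [e3]
  have := mul_le_mul_of_nonneg_left hA hrs
  nlinarith

/-- The pressure shifts each velocity by at most c/(γτ), so every term retains a gap (1 - 1/(γτ))c
below M. The power mean inequality transfers this gap to c̄. -/
theorem velocity_avg_le (h : FluxAverageData γ K M lam w ρ p u n) {r : ℝ} {m : E}
    (hr : r = ∑ i, w i * (ρ i * (1 - inner ℝ (u i) (n i) / lam)))
    (hm : m = ∑ i, w i • ((ρ i * (1 - inner ℝ (u i) (n i) / lam)) • u i - (p i / lam) • n i)) :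
    ‖m‖ ≤ r * (M - 0.28 * (√(γ * K) * r ^ ((γ - 1) / 2))) := by
  have hr0 : 0 < r := hr ▸ h.density_avg_pos
  have hlam := h.lam_pos
  have hγ := h.one_lt
  have hγ0 := h.gamma_pos
  have hτ := h.one_lt_tau
  have hτ2 := h.sq_tau
  have hM := h.M_pos
  have hle := h.le_lam
  have hrpow := h.rpow_avg_le hr
  set τ := √(2 + γ * (γ - 1)) with hτd
  have hτ0 : 0 < τ := by linarith
  set s := (γ - 1) / 2 with hs
  have hβ : 0 < 1 - 1 / (γ * τ) := by
    rw [sub_pos, div_lt_one (by positivity)]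
    nlinarith
  have hterm : ∀ i, ‖w i • ((ρ i * (1 - inner ℝ (u i) (n i) / lam)) • u i - (p i / lam) • n i)‖ ≤
      w i * (ρ i * (1 - inner ℝ (u i) (n i) / lam)) *
        (M - (1 - 1 / (γ * τ)) * (√(γ * K) * ρ i ^ s)) := by
    intro i
    have hρ := h.density_pos i
    have hp := h.pressure_pos i
    have hf := h.factor_pos i
    have hw := h.weight_nonneg i
    set c := √(γ * p i / ρ i) with hc
    have hc0 : 0 < c := Real.sqrt_pos.2 (by positivity)
    have hc2 : c ^ 2 = γ * p i / ρ i := Real.sq_sqrt (by positivity)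
    have hpc : p i = ρ i * c ^ 2 / γ := by rw [hc2]; field_simp
    have hsp := h.speed_le i
    have hu := norm_nonneg (u i)
    have hvl := le_of_abs_le (h.abs_inner_le (u i) i)
    have hic := h.isentrope_le_soundSpeed i
    rw [← hs, ← hc] at hic
    rw [← hc] at hsp
    -- λ - v ≥ τ(|u| + c) - |u| ≥ τc, since τ ≥ 1.
    have hlv : τ * c ≤ lam - inner ℝ (u i) (n i) := by nlinarith
    have hple : p i / lam ≤ ρ i * (1 - inner ℝ (u i) (n i) / lam) * (c / (γ * τ)) := by
      have e : ρ i * (1 - inner ℝ (u i) (n i) / lam) * (c / (γ * τ)) - p i / lam =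
          ρ i * c / (γ * τ * lam) * (lam - inner ℝ (u i) (n i) - τ * c) := by
        rw [hpc]; field_simp
      have : 0 ≤ ρ i * c / (γ * τ * lam) * (lam - inner ℝ (u i) (n i) - τ * c) :=
        mul_nonneg (by positivity) (by linarith)
      linarith
    rw [norm_smul, Real.norm_of_nonneg hw, mul_assoc]
    apply mul_le_mul_of_nonneg_left _ hw
    refine (norm_sub_le _ _).trans ?_
    rw [norm_smul, norm_smul, h.norm_normal, mul_one, Real.norm_of_nonneg (by positivity),
      Real.norm_of_nonneg (by positivity)]
    have h5 : ‖u i‖ + c / (γ * τ) ≤ M - (1 - 1 / (γ * τ)) * (√(γ * K) * ρ i ^ s) := by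
      have h6 := mul_le_mul_of_nonneg_left hic hβ.le
      have h7 : (1 - 1 / (γ * τ)) * c = c - c / (γ * τ) := by ring
      linarith
    have h8 := mul_le_mul_of_nonneg_left h5 (mul_pos hρ hf).le
    linarith
  have hnorm : ‖m‖ ≤ r * M - (1 - 1 / (γ * τ)) * √(γ * K) *
      ∑ i, w i * (ρ i * (1 - inner ℝ (u i) (n i) / lam)) * ρ i ^ s := by
    rw [hm]
    refine (norm_sum_le _ _).trans ((Finset.sum_le_sum fun i _ => hterm i).trans_eq ?_)
    rw [hr, Finset.sum_mul, Finset.mul_sum, ← Finset.sum_sub_distrib]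
    refine Finset.sum_congr rfl fun i _ => ?_
    ring
  -- At γ = 1 the product equals 1 - 1/√2 ≈ 0.293, so 0.28 leaves little room.
  have hθ : 0.28 ≤ (1 - 1 / (γ * τ)) * (1 - (γ - 1) / (2 * τ)) := by
    have h1 : τ ≤ 1.44 * γ := by
      refine (pow_le_pow_iff_left₀ hτ0.le (by positivity) two_ne_zero).1 ?_
      nlinarith
    have e : (1 - 1 / (γ * τ)) * (1 - (γ - 1) / (2 * τ)) - 0.28 =
        (1.44 * γ * τ ^ 2 - (γ * (γ - 1) + 2) * τ + (γ - 1)) / (2 * γ * τ ^ 2) := by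
      field_simp
      ring
    have : 0 ≤ (1.44 * γ * τ ^ 2 - (γ * (γ - 1) + 2) * τ + (γ - 1)) / (2 * γ * τ ^ 2) := by
      apply div_nonneg _ (by positivity)
      rw [add_comm (γ * (γ - 1)), ← hτ2]
      nlinarith [mul_le_mul_of_nonneg_right h1 (sq_nonneg τ)]
    linarith
  have hrs : 0 ≤ √(γ * K) * (r * r ^ s) := by positivity
  have h1 := mul_le_mul_of_nonneg_left hrpow (mul_nonneg hβ.le (Real.sqrt_nonneg (γ * K)))
  have h2 := mul_le_mul_of_nonneg_right hθ hrs
  linarith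

/-- The minimum entropy principle for the averaged state. -/
theorem isentrope_le_pressure_avg (h : FluxAverageData γ K M lam w ρ p u n) {r e : ℝ} {m : E}
    (hr : r = ∑ i, w i * (ρ i * (1 - inner ℝ (u i) (n i) / lam)))
    (hm : m = ∑ i, w i • ((ρ i * (1 - inner ℝ (u i) (n i) / lam)) • u i - (p i / lam) • n i))
    (he : e = ∑ i, w i * ((p i / (γ - 1) + ρ i * ‖u i‖ ^ 2 / 2) *
      (1 - inner ℝ (u i) (n i) / lam) - p i / lam * inner ℝ (u i) (n i))) :
    K * r ^ γ ≤ (γ - 1) * (e - r * ‖r⁻¹ • m‖ ^ 2 / 2) := by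
  have hr0 : 0 < r := hr ▸ h.density_avg_pos
  have hlam := h.lam_pos
  have hγ := h.one_lt
  have hκ : 0 < γ - 1 := sub_pos.2 hγ
  have hK := h.K_pos
  have hτ := h.one_lt_tau
  set pb := K * r ^ γ with hpbd
  have hpb : 0 < pb := by positivity
  set U := r⁻¹ • m with hU
  have hmU : m = r • U := by rw [hU, smul_inv_smul₀ hr0.ne']
  have hcb : √(γ * pb / r) = √(γ * K) * r ^ ((γ - 1) / 2) := h.sqrt_isentrope hr0
  have hUle : ‖U‖ ≤ M - 0.28 * √(γ * pb / r) := by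
    have := h.velocity_avg_le hr hm
    rw [hmU, norm_smul, Real.norm_of_nonneg hr0.le, ← hcb] at this
    exact le_of_mul_le_mul_left this hr0
  have hpt : ∀ i, (p i - pb) * (inner ℝ (u i) (n i) - inner ℝ U (n i)) ≤
      (lam - inner ℝ (u i) (n i)) * (p i / (γ - 1) + ρ i * ‖u i - U‖ ^ 2 / 2 -
        γ / (γ - 1) * ρ i * (pb / r) + pb) := by
    intro i
    have hρ := h.density_pos i
    have h1 := pressure_mul_le (p := p i) (v := inner ℝ (u i) (n i)) (vb := inner ℝ U (n i)) hγ
      (by linarith) h.sq_tau hρ hr0 hpb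
      (by
        rw [hpbd, Real.div_rpow hρ.le hr0.le]
        refine le_of_eq_of_le ?_ (h.le_pressure i)
        field_simp)
      (by rw [hcb]; exact h.isentrope_avg_le hr) h.le_lam
      (by linarith [le_of_abs_le (h.abs_inner_le (u i) i), h.speed_le i])
      ((le_of_abs_le (h.abs_inner_le U i)).trans hUle)
    refine h1.trans (mul_le_mul_of_nonneg_left ?_ (sub_pos.2 (h.inner_lt i)).le)
    have h2 : (inner ℝ (u i) (n i) - inner ℝ U (n i)) ^ 2 ≤ ‖u i - U‖ ^ 2 := by
      rw [← inner_sub_left]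
      exact sq_le_sq' (neg_le_of_abs_le (h.abs_inner_le _ i)) (le_of_abs_le (h.abs_inner_le _ i))
    gcongr
  -- Closedness removes the contributions of ū·n after summation.
  have hUn : ∑ i, w i * inner ℝ U (n i) = 0 := by
    have : inner ℝ U (∑ i, w i • n i) = (0 : ℝ) := by rw [h.sum_normal, inner_zero_right]
    simpa [inner_sum, inner_smul_right] using this
  have hUm : r * ‖U‖ ^ 2 = ∑ i, w i * ((ρ i * (1 - inner ℝ (u i) (n i) / lam)) *
      inner ℝ U (u i) - p i / lam * inner ℝ U (n i)) := by
    have : inner ℝ U m = r * ‖U‖ ^ 2 := by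
      rw [hmU, inner_smul_right, real_inner_self_eq_norm_sq]
    rw [← this, hm]
    simp [inner_sum, inner_smul_right, inner_sub_right]
  have hsum := Finset.sum_le_sum fun i (_ : i ∈ Finset.univ) =>
    mul_le_mul_of_nonneg_left (hpt i) (h.weight_nonneg i)
  rw [← sub_nonneg, ← Finset.sum_sub_distrib] at hsum
  -- Up to the vanishing normal term, the summed pointwise gaps are λ times the supporting affine
  -- function at the averaged state.
  have key : ∑ i, (w i * ((lam - inner ℝ (u i) (n i)) *
      (p i / (γ - 1) + ρ i * ‖u i - U‖ ^ 2 / 2 - γ / (γ - 1) * ρ i * (pb / r) + pb)) -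
      w i * ((p i - pb) * (inner ℝ (u i) (n i) - inner ℝ U (n i)))) =
      lam * (e - r * ‖U‖ ^ 2 + ‖U‖ ^ 2 / 2 * r - γ / (γ - 1) * (pb / r) * r + pb * ∑ i, w i) -
        pb * ∑ i, w i * inner ℝ U (n i) := by
    rw [hUm]
    conv_rhs => enter [1, 2, 1, 1, 2, 2]; rw [hr]
    conv_rhs => enter [1, 2, 1, 2, 2]; rw [hr]
    rw [he]
    simp only [Finset.mul_sum, ← Finset.sum_sub_distrib, ← Finset.sum_add_distrib]
    refine Finset.sum_congr rfl fun i _ => ?_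
    rw [norm_sub_sq_real, real_inner_comm U (u i)]
    field_simp
    ring
  rw [key, h.sum_weight, hUn] at hsum
  have h1 : 0 ≤ lam * (e - r * ‖U‖ ^ 2 / 2 - pb / (γ - 1)) := by
    refine le_of_le_of_eq hsum ?_
    field_simp
    ring
  have h2 := nonneg_of_mul_nonneg_right h1 hlam
  rw [sub_nonneg, div_le_iff₀ hκ] at h2
  linarith

end FluxAverageData

end Average

/-! ### From the Euler quadrature data to the abstract average -/

namespace Euler

variable {d : ℕ}

theorem density_normalFlux (γ : ℝ) (U : State d) (n : EuclideanSpace ℝ (Fin d)) :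
    (normalFlux γ U n).1 = density U * inner ℝ (velocity U) n := by
  simp only [normalFlux, flux, Prod.fst_sum, Prod.smul_fst, smul_eq_mul, PiLp.inner_apply,
    Finset.mul_sum]
  refine Finset.sum_congr rfl fun i _ => ?_
  simp
  ring

theorem momentum_normalFlux (γ : ℝ) (U : State d) (n : EuclideanSpace ℝ (Fin d)) :
    (normalFlux γ U n).2.1 =
      (density U * inner ℝ (velocity U) n) • velocity U + pressure γ U • n := by
  rw [← density_normalFlux γ]
  have hn : n = ∑ i, n i • EuclideanSpace.single i (1 : ℝ) := by
    ext j
    simp [Finset.sum_apply, Pi.single_apply]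
  conv_rhs => enter [2]; rw [hn]
  simp only [normalFlux, flux, Prod.fst_sum, Prod.snd_sum, Prod.smul_fst, Prod.smul_snd,
    Finset.sum_smul, Finset.smul_sum, smul_add, smul_eq_mul, Finset.sum_add_distrib]
  congr 1
  · refine Finset.sum_congr rfl fun i _ => ?_
    rw [smul_smul]
  · refine Finset.sum_congr rfl fun i _ => ?_
    rw [smul_comm]

theorem energy_normalFlux (γ : ℝ) (U : State d) (n : EuclideanSpace ℝ (Fin d)) :
    (normalFlux γ U n).2.2 = inner ℝ (velocity U) n * (energy U + pressure γ U) := by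
  simp only [normalFlux, flux, Prod.snd_sum, Prod.smul_snd, smul_eq_mul, PiLp.inner_apply,
    Finset.sum_mul]
  refine Finset.sum_congr rfl fun i _ => ?_
  simp
  ring

theorem energy_eq {γ : ℝ} (hγ : 1 < γ) (U : State d) :
    energy U = pressure γ U / (γ - 1) + density U * ‖velocity U‖ ^ 2 / 2 := by
  have : γ - 1 ≠ 0 := (sub_pos.2 hγ).ne'
  rw [pressure]
  field_simp
  ring

/-- Exponentiation gives the region p ≥ K ρ^γ, in which positive density already forces positive
pressure. -/
theorem Admissible.le_entropy_iff {γ s₀ m : ℝ} {U : State d} (hU : Admissible γ U) :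
    m ≤ entropy γ s₀ U ↔ Real.exp (m - s₀) * density U ^ γ ≤ pressure γ U := by
  rw [Real.rpow_def_of_pos hU.1, ← Real.exp_add, ← Real.le_log_iff_exp_le hU.2, entropy]
  constructor <;> intro h <;> linarith

namespace SurfaceQuadrature

variable (Q : SurfaceQuadrature d)

theorem zeta_pos (k : Fin Q.numFaces) (q : Fin (Q.numPts k)) : 0 < Q.zeta k q :=
  div_pos (mul_pos (norm_pos_iff.2 (Q.jac_ne_zero k q)) (Q.weight_pos k q)) Q.vol_pos

theorem norm_normal (k : Fin Q.numFaces) (q : Fin (Q.numPts k)) : ‖Q.normal k q‖ = 1 :=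
  norm_smul_inv_norm (𝕜 := ℝ) (Q.jac_ne_zero k q)

theorem surf_eq_sum : Q.surf = ∑ j : Q.Pt, Q.zeta j.1 j.2 :=
  (Fintype.sum_sigma (fun j : Q.Pt => Q.zeta j.1 j.2)).symm

theorem surf_pos [Nonempty Q.Pt] : 0 < Q.surf := by
  rw [surf_eq_sum]
  exact Finset.sum_pos (fun j _ => Q.zeta_pos j.1 j.2) Finset.univ_nonempty

end SurfaceQuadrature

theorem auxState_eq_sum (γ : ℝ) (Q : SurfaceQuadrature d) [Nonempty Q.Pt]
    (U : (k : Fin Q.numFaces) → Fin (Q.numPts k) → State d) :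
    auxState γ Q U = ∑ j : Q.Pt, (Q.zeta j.1 j.2 / Q.surf) •
      (U j.1 j.2 - (1 / lambdaStar γ Q U) • normalFlux γ (U j.1 j.2) (Q.normal j.1 j.2)) :=
  (Fintype.sum_sigma (fun j : Q.Pt => (Q.zeta j.1 j.2 / Q.surf) •
      (U j.1 j.2 - (1 / lambdaStar γ Q U) •
        normalFlux γ (U j.1 j.2) (Q.normal j.1 j.2)))).symm

theorem fluxAverageData {γ s₀ : ℝ} (hγ : 1 < γ) {Q : SurfaceQuadrature d} [Nonempty Q.Pt]
    (hQ : Q.Closed) {U : (k : Fin Q.numFaces) → Fin (Q.numPts k) → State d}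
    (hU : ∀ k q, Admissible γ (U k q)) :
    FluxAverageData γ
      (Real.exp (Finset.univ.inf' Finset.univ_nonempty
          (fun j : Q.Pt => entropy γ s₀ (U j.1 j.2)) - s₀))
      (Finset.univ.sup' Finset.univ_nonempty (fun j : Q.Pt => charSpeed γ (U j.1 j.2)))
      (lambdaStar γ Q U)
      (fun j : Q.Pt => Q.zeta j.1 j.2 / Q.surf)
      (fun j => density (U j.1 j.2)) (fun j => pressure γ (U j.1 j.2))
      (fun j => velocity (U j.1 j.2)) (fun j => Q.normal j.1 j.2) where
  one_lt := hγ
  K_pos := Real.exp_pos _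
  weight_nonneg j := (div_pos (Q.zeta_pos j.1 j.2) Q.surf_pos).le
  sum_weight := by
    rw [← Finset.sum_div, ← Q.surf_eq_sum, div_self Q.surf_pos.ne']
  sum_normal := by
    have : ∑ j : Q.Pt, Q.zeta j.1 j.2 • Q.normal j.1 j.2 = 0 :=
      (Fintype.sum_sigma (fun j : Q.Pt => Q.zeta j.1 j.2 • Q.normal j.1 j.2)).trans hQ
    simp only [div_eq_inv_mul, mul_smul]
    rw [← Finset.smul_sum, this, smul_zero]
  norm_normal j := Q.norm_normal j.1 j.2
  density_pos j := (hU j.1 j.2).1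
  le_pressure j := (hU j.1 j.2).le_entropy_iff.1
    (Finset.inf'_le (fun j : Q.Pt => entropy γ s₀ (U j.1 j.2)) (Finset.mem_univ j))
  speed_le j :=
    Finset.le_sup' (fun j : Q.Pt => charSpeed γ (U j.1 j.2)) (Finset.mem_univ j)
  le_lam := by
    refine mul_le_mul_of_nonneg_right (le_max_right _ _) ?_
    obtain ⟨j⟩ := ‹Nonempty Q.Pt›
    refine le_trans ?_
      (Finset.le_sup' (fun j : Q.Pt => charSpeed γ (U j.1 j.2)) (Finset.mem_univ j))
    exact add_nonneg (norm_nonneg _) (Real.sqrt_nonneg _)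

end Euler

open Euler in
theorem auxState_minimum_entropy {d : ℕ} (γ s₀ : ℝ) (hγ : 1 < γ)
    (Q : SurfaceQuadrature d) [Nonempty Q.Pt] (hQ : Q.Closed)
    (U : (k : Fin Q.numFaces) → Fin (Q.numPts k) → State d)
    (hU : ∀ k q, Admissible γ (U k q)) :
    0 < density (auxState γ Q U) ∧
      Real.exp (Finset.univ.inf' Finset.univ_nonempty
          (fun j : Q.Pt => entropy γ s₀ (U j.1 j.2)) - s₀) * density (auxState γ Q U) ^ γ ≤
        pressure γ (auxState γ Q U) := by
  have h := fluxAverageData (s₀ := s₀) hγ hQ hU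
  have hr : density (auxState γ Q U) = ∑ j : Q.Pt, Q.zeta j.1 j.2 / Q.surf *
      (density (U j.1 j.2) *
        (1 - inner ℝ (velocity (U j.1 j.2)) (Q.normal j.1 j.2) / lambdaStar γ Q U)) := by
    rw [auxState_eq_sum, density, Prod.fst_sum]
    refine Finset.sum_congr rfl fun j _ => ?_
    rw [Prod.smul_fst, Prod.fst_sub, Prod.smul_fst, density_normalFlux, smul_eq_mul, smul_eq_mul]
    rw [density]
    ring
  have hm : momentum (auxState γ Q U) = ∑ j : Q.Pt, (Q.zeta j.1 j.2 / Q.surf) •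
      ((density (U j.1 j.2) *
        (1 - inner ℝ (velocity (U j.1 j.2)) (Q.normal j.1 j.2) / lambdaStar γ Q U)) •
          velocity (U j.1 j.2) -
        (pressure γ (U j.1 j.2) / lambdaStar γ Q U) • Q.normal j.1 j.2) := by
    rw [auxState_eq_sum, momentum, Prod.snd_sum, Prod.fst_sum]
    refine Finset.sum_congr rfl fun j _ => ?_
    have hv : (U j.1 j.2).2.1 = density (U j.1 j.2) • velocity (U j.1 j.2) := by
      rw [velocity, smul_inv_smul₀ (hU j.1 j.2).1.ne', momentum]
    rw [Prod.smul_snd, Prod.smul_fst, Prod.snd_sub, Prod.fst_sub, Prod.smul_snd, Prod.smul_fst,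
      momentum_normalFlux, hv]
    module
  have he : energy (auxState γ Q U) = ∑ j : Q.Pt, Q.zeta j.1 j.2 / Q.surf *
      ((pressure γ (U j.1 j.2) / (γ - 1) +
          density (U j.1 j.2) * ‖velocity (U j.1 j.2)‖ ^ 2 / 2) *
        (1 - inner ℝ (velocity (U j.1 j.2)) (Q.normal j.1 j.2) / lambdaStar γ Q U) -
        pressure γ (U j.1 j.2) / lambdaStar γ Q U *
          inner ℝ (velocity (U j.1 j.2)) (Q.normal j.1 j.2)) := by
    rw [auxState_eq_sum, energy, Prod.snd_sum, Prod.snd_sum]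
    refine Finset.sum_congr rfl fun j _ => ?_
    rw [← energy_eq hγ, Prod.smul_snd, Prod.smul_snd, Prod.snd_sub, Prod.snd_sub, Prod.smul_snd,
      Prod.smul_snd, energy_normalFlux, smul_eq_mul, smul_eq_mul]
    rw [energy]
    ring
  exact ⟨hr ▸ h.density_avg_pos, h.isentrope_le_pressure_avg hr hm he⟩

theorem lemma4 {d : ℕ} (γ s₀ : ℝ) (hγ : 1 < γ)
    (Q : Euler.SurfaceQuadrature d) [Nonempty Q.Pt] (hQ : Q.Closed)
    (U : (k : Fin Q.numFaces) → Fin (Q.numPts k) → Euler.State d)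
    (hU : ∀ k q, Euler.Admissible γ (U k q)) :
    Euler.Admissible γ (Euler.auxState γ Q U) ∧
      Finset.univ.inf' Finset.univ_nonempty
          (fun j : Q.Pt => Euler.entropy γ s₀ (U j.1 j.2)) ≤
        Euler.entropy γ s₀ (Euler.auxState γ Q U) := by
  obtain ⟨hρ, hp⟩ := auxState_minimum_entropy γ s₀ hγ Q hQ U hU
  have hadm : Euler.Admissible γ (Euler.auxState γ Q U) :=
    ⟨hρ, (mul_pos (Real.exp_pos _) (Real.rpow_pos_of_pos hρ γ)).trans_le hp⟩
  exact ⟨hadm, hadm.le_entropy_iff.2 hp⟩
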